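/- **Lemma 2.7.** A hypergraph $H$ consists of a vertex set $V(H)$ and a set $E(H)$ of subsets of $V(H)$, its edges; write $|H|=|E(H)|$. It is $k$-uniform if every edge has exactly $k$ vertices, and its maximum degree $\Delta(H)$ is the largest number of edges containing a common vertex. We say that $H$ has an $r$-regular subgraph if there are a collection $S\subseteq E(H)$ and a nonempty set $U\subseteq V(H)$ such that every vertex of $U$ lies in exactly $r$ edges of $S$ and no vertex outside $U$ lies in an edge of $S$. Let $\log$ denote $\log_2$. For every integer $r\ge 1$ there is a constant $c(r)>2$, depending only on $r$, such that the following holds. Let $k\ge 2$ and $n$ be integers, and let $H$ be a $k$-uniform hypergraph on $n$ vertices with at least one edge, with maximum degree $\Delta=\Delta(H)$, and with no $r$-regular subgraph. If $|H|\ge c(r)\,k\,\Delta$, then $$|H|\le \frac{6\,n^{k/(k-1)}\,\Delta^{(k-2)/(k-1)}}{\left(\log\log\frac{|H|}{k\Delta}\right)^{\frac{1}{2(k-1)}}}.$$ -/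

import Mathlib

namespace Hypergraph

/-- `H` is `k`-uniform: every edge has exactly `k` vertices
(`Set.ncard` of an infinite set is `0`, so finiteness is demanded as well). -/
def IsUniform {α : Type*} (H : Hypergraph α) (k : ℕ) : Prop :=
  ∀ e ∈ H.edgeSet, e.Finite ∧ e.ncard = k

/-- The degree of `v`: the number of edges containing `v`. -/
noncomputable def degree {α : Type*} (H : Hypergraph α) (v : α) : ℕ :=
  {e | e ∈ H.edgeSet ∧ v ∈ e}.ncard

/-- The maximum degree of a hypergraph with finitely many vertices
(it is `0` when there are no vertices). -/
noncomputable def maxDegree {α : Type*} (H : Hypergraph α) : ℕ :=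
  sSup (H.degree '' H.vertexSet)

/-- `H` has an `r`-regular subgraph: there is a collection `S` of edges of `H` which covers each
vertex of some nonempty set `U` exactly `r` times, and covers no other vertices. -/
def HasRegularSubgraph {α : Type*} (H : Hypergraph α) (r : ℕ) : Prop :=
  ∃ S : Set (Set α), S ⊆ H.edgeSet ∧ ∃ U : Set α, U ⊆ H.vertexSet ∧ U.Nonempty ∧
    (∀ v ∈ U, {e | e ∈ S ∧ v ∈ e}.ncard = r) ∧ (∀ v, v ∉ U → ∀ e ∈ S, v ∉ e)

end Hypergraph

/-! Count matchings of size `t = ⌊|H|/(kΔ)⌋`. An edge meets at most `kΔ` edges, itself included, so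
a greedy choice gives at least `(kΔ)^t` such matchings, while their vertex sets are among the
`kt`-subsets of the vertices. If more than `κ^t` matchings, with `κ = t/√(log t)`, had the same
vertex set, then these `t`-sets of edges would contain a sunflower with `r` petals. As its members
cover the same vertices, each petal covers exactly what the core leaves, so the union of the petals
is `r`-regular. Hence `(kΔ)^t ≤ C(n,kt) κ^t`, and `t`-th roots give the bound
(`pow_le_choose_mul_of_not_hasRegularSubgraph`, `pow_mul_sqrt_le`).

The sunflower bound `κ^t` comes from spreadness. A core maximising a weighted degree has a
`κ`-spread link. Colour the ground set at random with `2r` colours, in `r` pairs: each pair of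
classes is likely to contain a member of the link, so some colouring yields `r` disjoint members.
For one pair, the first class covers all but `s` points of some member (an encoding argument), and
the second class catches such a residue (second moment). -/

/-! ### Spread families: two rounds of exposure, and disjoint members -/

open Finset in
/-- Recolouring: the colourings that agree with `c'` outside `A`. -/
theorem card_colorings_eq_off {X K : Type*} [Fintype X] [DecidableEq X] [Fintype K]
    [DecidableEq K] (c' : X → K) (A : Finset X) :
    #{c : X → K | ∀ x ∉ A, c x = c' x} = Fintype.card K ^ #A := by
  have h : ({c : X → K | ∀ x ∉ A, c x = c' x} : Finset (X → K)) =
      Fintype.piFinset (fun x => if x ∈ A then univ else {c' x}) := by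
    ext c
    simp only [mem_filter, mem_univ, true_and, Fintype.mem_piFinset]
    refine forall_congr' fun x => ?_
    by_cases hx : x ∈ A <;> simp [hx]
  rw [h, Fintype.card_piFinset]
  have : ∀ x, #(if x ∈ A then (univ : Finset K) else {c' x}) =
      if x ∈ A then Fintype.card K else 1 := by
    intro x; split_ifs <;> simp
  simp only [this, prod_ite, prod_const, one_pow, mul_one]
  simp

open Finset in
/-- A spread family has few members meeting a given set in at least `s` points. -/
theorem card_filter_lt_card_inter_mul_pow_le {X : Type*} [DecidableEq X] (F : Finset (Finset X))
    {κ : ℝ} (hκ : 0 < κ)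
    (hF : ∀ T, (#{A ∈ F | T ⊆ A} : ℝ) * κ ^ #T ≤ #F) {t : ℕ} (s : ℕ) (B : Finset X)
    (hB : #B ≤ t) :
    (#{A ∈ F | s < #(A ∩ B)} : ℝ) * κ ^ s ≤ 2 ^ t * #F := by
  have hsub : ({A ∈ F | s < #(A ∩ B)} : Finset (Finset X)) ⊆
      (B.powersetCard s).biUnion fun T => {A ∈ F | T ⊆ A} := by
    intro A hA
    simp only [mem_filter] at hA
    obtain ⟨T, hT, hTs⟩ := exists_subset_card_eq hA.2.le
    simp only [mem_biUnion, mem_powersetCard, mem_filter]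
    exact ⟨T, ⟨hT.trans inter_subset_right, hTs⟩, hA.1, hT.trans inter_subset_left⟩
  have h1 : (#{A ∈ F | s < #(A ∩ B)} : ℝ) ≤
      ∑ T ∈ B.powersetCard s, (#{A ∈ F | T ⊆ A} : ℝ) := by
    exact_mod_cast (card_le_card hsub).trans card_biUnion_le
  calc (#{A ∈ F | s < #(A ∩ B)} : ℝ) * κ ^ s
      ≤ (∑ T ∈ B.powersetCard s, (#{A ∈ F | T ⊆ A} : ℝ)) * κ ^ s := by gcongr
    _ = ∑ T ∈ B.powersetCard s, (#{A ∈ F | T ⊆ A} : ℝ) * κ ^ s := by rw [sum_mul]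
    _ ≤ ∑ T ∈ B.powersetCard s, (#F : ℝ) := by
        refine sum_le_sum fun T hT => ?_
        rw [← (mem_powersetCard.1 hT).2]
        exact hF T
    _ = #(B.powersetCard s) * (#F : ℝ) := by simp
    _ ≤ 2 ^ t * #F := by
        gcongr
        have : #(B.powersetCard s) ≤ #B.powerset := card_le_card fun T hT =>
          mem_powerset.2 (mem_powersetCard.1 hT).1
        rw [card_powerset] at this
        exact_mod_cast this.trans (Nat.pow_le_pow_right (by norm_num) hB)

open Finset in
/-- First exposure: for most pairs of a colouring and a member `A` of a spread family, the colour
class `i` together with `A` contains a member that is almost covered by the class. -/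
theorem sum_card_no_small_residue_mul_pow_le {X K : Type*} [Fintype X] [DecidableEq X] [Fintype K]
    [DecidableEq K] (F : Finset (Finset X)) {κ : ℝ} (hκ : 0 < κ)
    (hF : ∀ T, (#{A ∈ F | T ⊆ A} : ℝ) * κ ^ #T ≤ #F) {t : ℕ} (hFt : ∀ A ∈ F, #A ≤ t) (s : ℕ)
    (i : K) :
    (∑ c : X → K, (#{A ∈ F | ∀ A' ∈ F, (∀ x ∈ A', x ∉ A → c x = i) →
        s < #{x ∈ A' | c x ≠ i}} : ℝ)) * κ ^ s ≤
      (2 * Fintype.card K) ^ t * #F * Fintype.card (X → K) := by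
  classical
  set q := Fintype.card K with hq
  have hq1 : 1 ≤ q := Fintype.card_pos_iff.2 ⟨i⟩
  let bad : Finset ((X → K) × Finset X) := {p ∈ univ ×ˢ F |
    ∀ A' ∈ F, (∀ x ∈ A', x ∉ p.2 → p.1 x = i) → s < #{x ∈ A' | p.1 x ≠ i}}
  have hsum : (∑ c : X → K, #{A ∈ F | ∀ A' ∈ F, (∀ x ∈ A', x ∉ A → c x = i) →
        s < #{x ∈ A' | c x ≠ i}}) = #bad := by
    simp only [bad, card_filter, sum_product]
  -- The choice sees the colouring alone. After recolouring it does not know `A`, so spreadness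
  -- bounds the `A` that meet the chosen set in more than `s` points.
  let pick : (X → K) → Finset X := fun c =>
    if h : ∃ A ∈ F, ∀ x ∈ A, c x = i then h.choose else ∅
  have hpick : ∀ c, (∃ A ∈ F, ∀ x ∈ A, c x = i) → pick c ∈ F ∧ ∀ x ∈ pick c, c x = i := by
    intro c h
    simp only [pick, dif_pos h]
    exact h.choose_spec
  have hpickt : ∀ c, #(pick c) ≤ t := by
    intro c
    by_cases h : ∃ A ∈ F, ∀ x ∈ A, c x = i
    · exact hFt _ (hpick c h).1
    · simp [pick, dif_neg h]
  let tgt : Finset ((X → K) × Finset X) := {p ∈ univ ×ˢ F | s < #(p.2 ∩ pick p.1)}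
  let f : (X → K) × Finset X → (X → K) × Finset X :=
    fun p => (fun x => if x ∈ p.2 then i else p.1 x, p.2)
  have hmaps : ∀ p ∈ bad, f p ∈ tgt := by
    rintro ⟨c, A⟩ hp
    simp only [bad, mem_filter, mem_product, mem_univ, true_and] at hp
    simp only [tgt, f, mem_filter, mem_product, mem_univ, true_and]
    obtain ⟨hA, hbad⟩ := hp
    refine ⟨hA, ?_⟩
    have hex : ∃ B ∈ F, ∀ x ∈ B, (fun x => if x ∈ A then i else c x) x = i :=
      ⟨A, hA, fun x hx => by simp [hx]⟩
    obtain ⟨h1, h2⟩ := hpick _ hex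
    set P := pick (fun x => if x ∈ A then i else c x)
    refine (hbad P h1 fun x hx hxA => by simpa [hxA] using h2 x hx).trans_le (card_le_card ?_)
    intro x hx
    simp only [mem_filter] at hx
    refine mem_inter.2 ⟨?_, hx.1⟩
    by_contra hxA
    exact hx.2 (by simpa [hxA] using h2 x hx.1)
  -- Recolouring `A` loses only the old colours on `A`.
  have hfib : ∀ p ∈ tgt, #{a ∈ bad | f a = p} ≤ q ^ t := by
    rintro ⟨c', A⟩ hp
    simp only [tgt, mem_filter, mem_product, mem_univ, true_and] at hp
    calc #{a ∈ bad | f a = (c', A)}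
        ≤ #(({c : X → K | ∀ x ∉ A, c x = c' x} : Finset (X → K)).image fun c => (c, A)) := by
          refine card_le_card ?_
          rintro ⟨c, B⟩ hc
          simp only [mem_filter, f, Prod.mk.injEq] at hc
          obtain ⟨-, h1, rfl⟩ := hc
          simp only [mem_image, mem_filter, mem_univ, true_and, Prod.mk.injEq, and_true,
            exists_eq_right]
          intro x hx
          rw [← h1]; simp [hx]
      _ ≤ #({c : X → K | ∀ x ∉ A, c x = c' x} : Finset (X → K)) := card_image_le
      _ = q ^ #A := card_colorings_eq_off c' A
      _ ≤ q ^ t := Nat.pow_le_pow_right hq1 (hFt A hp.1)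
  have hbt : #bad ≤ q ^ t * #tgt := card_le_mul_card_image_of_maps_to hmaps _ hfib
  have htgt : (#tgt : ℝ) * κ ^ s ≤ Fintype.card (X → K) * (2 ^ t * #F) := by
    have : (#tgt : ℝ) = ∑ c : X → K, (#{A ∈ F | s < #(A ∩ pick c)} : ℝ) := by
      norm_cast
      simp only [tgt, card_filter, sum_product]
    rw [this, sum_mul]
    calc _ ≤ ∑ c : X → K, (2 ^ t * #F : ℝ) :=
          sum_le_sum fun c _ => card_filter_lt_card_inter_mul_pow_le F hκ hF s _ (hpickt c)
      _ = _ := by rw [sum_const, card_univ, nsmul_eq_mul]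
  have hbt' : (#bad : ℝ) ≤ q ^ t * #tgt := by exact_mod_cast hbt
  have hsum' : (∑ c : X → K, (#{A ∈ F | ∀ A' ∈ F, (∀ x ∈ A', x ∉ A → c x = i) →
        s < #{x ∈ A' | c x ≠ i}} : ℝ)) = #bad := by exact_mod_cast hsum
  rw [hsum']
  calc (#bad : ℝ) * κ ^ s ≤ q ^ t * #tgt * κ ^ s := by gcongr
    _ = q ^ t * (#tgt * κ ^ s) := by ring
    _ ≤ q ^ t * (Fintype.card (X → K) * (2 ^ t * #F)) := by gcongr
    _ = _ := by rw [mul_pow]; ring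

open Finset in
/-- Among the colourings with a prescribed class `W` of colour `i`, a set `T` disjoint from `W`
has colour `j` with probability `(q - 1) ^ (-#T)`. -/
theorem card_colorings_class_mul_pow {X K : Type*} [Fintype X] [DecidableEq X] [Fintype K]
    [DecidableEq K] {i j : K} (hij : i ≠ j) (W T : Finset X) (hWT : Disjoint W T) :
    #{c : X → K | (∀ x, c x = i ↔ x ∈ W) ∧ ∀ x ∈ T, c x = j} * (Fintype.card K - 1) ^ #T =
      #{c : X → K | ∀ x, c x = i ↔ x ∈ W} := by
  have h1 : ({c : X → K | (∀ x, c x = i ↔ x ∈ W) ∧ ∀ x ∈ T, c x = j} : Finset (X → K)) =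
      Fintype.piFinset (fun x => if x ∈ W then {i} else if x ∈ T then {j} else univ.erase i) := by
    ext c
    simp only [mem_filter, mem_univ, true_and, Fintype.mem_piFinset, ← forall_and]
    refine forall_congr' fun x => ?_
    by_cases hx : x ∈ W
    · simp [hx, disjoint_left.1 hWT hx]
    · by_cases hx' : x ∈ T
      · simp only [hx, hx', if_true, if_false, mem_singleton, iff_false, true_imp_iff]
        exact ⟨fun h => h.2, fun h => ⟨fun h' => hij (h'.symm.trans h), h⟩⟩
      · simp [hx, hx']
  have h2 : ({c : X → K | ∀ x, c x = i ↔ x ∈ W} : Finset (X → K)) =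
      Fintype.piFinset (fun x => if x ∈ W then {i} else univ.erase i) := by
    ext c
    simp only [mem_filter, mem_univ, true_and, Fintype.mem_piFinset]
    refine forall_congr' fun x => ?_
    by_cases hx : x ∈ W <;> simp [hx]
  rw [h1, h2, Fintype.card_piFinset, Fintype.card_piFinset]
  have h3 : (Fintype.card K - 1) ^ #T = ∏ x, if x ∈ T then Fintype.card K - 1 else 1 := by
    simp
  rw [h3, ← prod_mul_distrib]
  refine prod_congr rfl fun x _ => ?_
  by_cases hx : x ∈ W
  · simp [hx, disjoint_left.1 hWT hx]
  · by_cases hx' : x ∈ T <;> simp [hx, hx', card_erase_of_mem, card_univ]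

open Finset in
/-- Second exposure (second moment method): small spread sets `R A` disjoint from the colour class
`W` of `i` are likely to fit into the colour class of `j`. -/
theorem card_class_mul_card_le_of_spread {X K : Type*} [Fintype X] [DecidableEq X] [Fintype K]
    [DecidableEq K] {i j : K} (hij : i ≠ j) (W : Finset X) (G : Finset (Finset X))
    (R : Finset X → Finset X) (s : ℕ) (hRW : ∀ A ∈ G, Disjoint W (R A))
    (hRs : ∀ A ∈ G, #(R A) ≤ s) {κ m : ℝ} (hκ : 0 < κ) (hm : 0 ≤ m)
    (hG : ∀ T, (#{A ∈ G | T ⊆ R A} : ℝ) * κ ^ #T ≤ m) :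
    (#G : ℝ) * #{c : X → K | ∀ x, c x = i ↔ x ∈ W} ≤
      #{c : X → K | (∀ x, c x = i ↔ x ∈ W) ∧ ∃ A ∈ G, ∀ x ∈ R A, c x = j} *
        ((1 + Fintype.card K / κ) ^ s * m) := by
  classical
  rcases G.eq_empty_or_nonempty with rfl | hGne
  · simp
  set C : Finset (X → K) := {c : X → K | ∀ x, c x = i ↔ x ∈ W} with hC
  set p : ℕ := Fintype.card K - 1 with hp
  have hp1 : 1 ≤ p := by
    have : 1 < Fintype.card K := Fintype.one_lt_card_iff.2 ⟨i, j, hij⟩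
    omega
  have hp0 : (0 : ℝ) < p := by exact_mod_cast hp1
  have hpK : (p : ℝ) ≤ Fintype.card K := by exact_mod_cast Nat.sub_le _ _
  -- Indicators divided by their probability given the class `W`, so each has conditional mean 1;
  -- outside `W` only `p` colours remain.
  let χ : (X → K) → Finset X → ℝ := fun c A => if ∀ x ∈ R A, c x = j then (p : ℝ) ^ #(R A) else 0
  let N : (X → K) → ℝ := fun c => ∑ A ∈ G, χ c A
  have hcard : ∀ T, Disjoint W T →
      (#{c ∈ C | ∀ x ∈ T, c x = j} : ℝ) * p ^ #T = #C := by
    intro T hT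
    have := card_colorings_class_mul_pow hij W T hT
    rw [hC, filter_filter]
    exact_mod_cast this
  have hmean : ∑ c ∈ C, N c = #G * #C := by
    simp only [N]
    rw [sum_comm]
    have : ∀ A ∈ G, ∑ c ∈ C, χ c A = #C := by
      intro A hA
      simp only [χ]
      rw [← sum_filter, sum_const, nsmul_eq_mul, hcard _ (hRW A hA)]
    rw [sum_congr rfl this, sum_const, nsmul_eq_mul]
  have hpair : ∀ A ∈ G, ∀ B ∈ G, ∑ c ∈ C, χ c A * χ c B ≤
      #C * ∑ T ∈ (R A).powerset, if T ⊆ R B then (p : ℝ) ^ #T else 0 := by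
    intro A hA B hB
    have h1 : ∀ c, χ c A * χ c B =
        if ∀ x ∈ R A ∪ R B, c x = j then (p : ℝ) ^ #(R A) * p ^ #(R B) else 0 := by
      intro c
      simp only [χ, mem_union, or_imp, forall_and]
      split_ifs <;> simp_all
    simp only [h1]
    rw [← sum_filter, sum_const, nsmul_eq_mul]
    have h2 : (p : ℝ) ^ #(R A) * p ^ #(R B) = p ^ #(R A ∪ R B) * p ^ #(R A ∩ R B) := by
      rw [← pow_add, ← pow_add, card_union_add_card_inter]
    rw [h2, ← mul_assoc, hcard _ (disjoint_union_right.2 ⟨hRW A hA, hRW B hB⟩)]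
    gcongr
    rw [← sum_filter]
    -- Enlarging this one term to a sum over all `T` in both sets makes the sum over `B` a count of
    -- the `B` with `T ⊆ R B`, which `hG` controls.
    calc (p : ℝ) ^ #(R A ∩ R B) = ∑ T ∈ {R A ∩ R B}, (p : ℝ) ^ #T := by simp
      _ ≤ _ := by
        refine sum_le_sum_of_subset_of_nonneg ?_ fun _ _ _ => by positivity
        simp
  have hsq : ∑ c ∈ C, N c ^ 2 ≤ #C * (#G * ((1 + Fintype.card K / κ) ^ s * m)) := by
    have h1 : ∀ c, N c ^ 2 = ∑ A ∈ G, ∑ B ∈ G, χ c A * χ c B := by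
      intro c; rw [sq, sum_mul_sum]
    simp only [h1]
    rw [sum_comm]
    have h2 : ∀ A ∈ G, ∑ c ∈ C, ∑ B ∈ G, χ c A * χ c B ≤
        #C * ((1 + Fintype.card K / κ) ^ s * m) := by
      intro A hA
      rw [sum_comm]
      calc _ ≤ ∑ B ∈ G, #C * ∑ T ∈ (R A).powerset, (if T ⊆ R B then (p : ℝ) ^ #T else 0) :=
            sum_le_sum fun B hB => hpair A hA B hB
        _ = #C * ∑ T ∈ (R A).powerset, (#{B ∈ G | T ⊆ R B} : ℝ) * (p : ℝ) ^ #T := by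
            rw [← mul_sum, sum_comm]
            congr 1
            refine sum_congr rfl fun T _ => ?_
            rw [← sum_filter, sum_const, nsmul_eq_mul]
        _ ≤ #C * ∑ T ∈ (R A).powerset, (p / κ) ^ #T * 1 ^ (#(R A) - #T) * m := by
            refine mul_le_mul_of_nonneg_left (sum_le_sum fun T _ => ?_) (by positivity)
            rw [one_pow, mul_one, div_pow, div_mul_eq_mul_div, le_div_iff₀ (by positivity)]
            calc _ = (p : ℝ) ^ #T * (#{B ∈ G | T ⊆ R B} * κ ^ #T) := by ring
              _ ≤ _ := by gcongr; exact hG T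
        _ = #C * ((p / κ + 1) ^ #(R A) * m) := by
            rw [← sum_mul, sum_pow_mul_eq_add_pow]
        _ ≤ #C * ((1 + Fintype.card K / κ) ^ s * m) := by
            rw [add_comm (1 : ℝ)]
            gcongr
            calc ((p : ℝ) / κ + 1) ^ #(R A) ≤ (p / κ + 1) ^ s :=
                  pow_le_pow_right₀ (by linarith [show (0 : ℝ) ≤ p / κ by positivity]) (hRs A hA)
              _ ≤ _ := by gcongr
    calc _ ≤ ∑ A ∈ G, #C * ((1 + Fintype.card K / κ) ^ s * m) := sum_le_sum h2
      _ = _ := by rw [sum_const, nsmul_eq_mul]; ring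
  set D : Finset (X → K) :=
    {c : X → K | (∀ x, c x = i ↔ x ∈ W) ∧ ∃ A ∈ G, ∀ x ∈ R A, c x = j} with hD
  have hDC : D ⊆ C := fun c hc => by
    simp only [hD, hC, mem_filter, mem_univ, true_and] at hc ⊢
    exact hc.1
  have hND : ∑ c ∈ C, N c = ∑ c ∈ D, N c := by
    symm
    refine sum_subset hDC fun c hc hcD => sum_eq_zero fun A hA => if_neg fun h => hcD ?_
    simp only [hD, hC, mem_filter, mem_univ, true_and] at hc ⊢
    exact ⟨hc, A, hA, h⟩
  have hCS : (#G * #C : ℝ) ^ 2 ≤ #D * (#C * (#G * ((1 + Fintype.card K / κ) ^ s * m))) := by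
    rw [← hmean, hND]
    refine sq_sum_le_card_mul_sum_sq.trans ?_
    gcongr
    exact (sum_le_sum_of_subset_of_nonneg hDC fun _ _ _ => sq_nonneg _).trans hsq
  have hG0 : (0 : ℝ) < #G := by exact_mod_cast hGne.card_pos
  rcases C.eq_empty_or_nonempty with hCe | hCne
  · rw [hCe]; simp; positivity
  have hC0 : (0 : ℝ) < #C := by exact_mod_cast hCne.card_pos
  refine le_of_mul_le_mul_left ?_ (mul_pos hG0 hC0)
  calc _ = (#G * #C : ℝ) ^ 2 := by ring
    _ ≤ _ := hCS
    _ = _ := by ring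

open Finset in
/-- If most members of a spread family have a small residue outside `W`, then most colourings with
colour class `W` of `i` have a member of the family inside the union of the classes `i` and `j`. -/
theorem card_class_misses_le {X K : Type*} [Fintype X] [DecidableEq X] [Fintype K]
    [DecidableEq K] {i j : K} (hij : i ≠ j) (F : Finset (Finset X)) (hFne : F.Nonempty) {κ δ : ℝ}
    (hκ : 0 < κ) (hδ : 0 < δ) (hF : ∀ T, (#{A ∈ F | T ⊆ A} : ℝ) * κ ^ #T ≤ #F) (s : ℕ)
    (h2 : (1 + Fintype.card K / κ) ^ s ≤ 1 + δ) (W : Finset X)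
    (hW : (1 - δ) * #F ≤ #{A ∈ F | ∃ A' ∈ F, (∀ x ∈ A', x ∉ A → x ∈ W) ∧ #(A' \ W) ≤ s}) :
    (#{c : X → K | (∀ x, c x = i ↔ x ∈ W) ∧ ¬ ∃ A ∈ F, ∀ x ∈ A, c x = i ∨ c x = j} : ℝ) ≤
      2 * δ * #{c : X → K | ∀ x, c x = i ↔ x ∈ W} := by
  classical
  set G : Finset (Finset X) :=
    {A ∈ F | ∃ A' ∈ F, (∀ x ∈ A', x ∉ A → x ∈ W) ∧ #(A' \ W) ≤ s} with hG
  have hGex : ∀ A ∈ G, ∃ A' ∈ F, (∀ x ∈ A', x ∉ A → x ∈ W) ∧ #(A' \ W) ≤ s := fun A hA =>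
    (mem_filter.1 hA).2
  have hGF : G ⊆ F := filter_subset _ _
  choose! P hPF hPA hPs using hGex
  set C : Finset (X → K) := {c : X → K | ∀ x, c x = i ↔ x ∈ W} with hC
  set D : Finset (X → K) :=
    {c : X → K | (∀ x, c x = i ↔ x ∈ W) ∧ ∃ A ∈ G, ∀ x ∈ P A \ W, c x = j} with hD
  have key := card_class_mul_card_le_of_spread hij W G (fun A => P A \ W) s
    -- The residue `P A \ W` lies inside `A`, so the residues, indexed by `A`, inherit the
    -- spreadness of `F`.
    (fun A _ => disjoint_sdiff) hPs hκ (Nat.cast_nonneg #F) (fun T => by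
      refine le_trans ?_ (hF T)
      gcongr
      refine fun A hA => mem_filter.2 ⟨hGF (mem_filter.1 hA).1, fun x hx => ?_⟩
      have hTA := (mem_filter.1 hA).2
      have hA := (mem_filter.1 hA).1
      have := mem_sdiff.1 (hTA hx)
      by_contra hxA
      exact this.2 (hPA A hA x this.1 hxA))
  have hF0 : (0 : ℝ) < #F := by exact_mod_cast hFne.card_pos
  have hDC : D ⊆ C := fun c hc => by
    simp only [hD, hC, mem_filter, mem_univ, true_and] at hc ⊢
    exact hc.1
  have hDle : (#D : ℝ) ≤ #C := by exact_mod_cast card_le_card hDC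
  have h3 : (1 - δ) * #C ≤ #D * (1 + δ) := by
    refine le_of_mul_le_mul_left ?_ hF0
    calc #F * ((1 - δ) * #C) = ((1 - δ) * #F) * #C := by ring
      _ ≤ #G * #C := by gcongr
      _ ≤ #D * ((1 + Fintype.card K / κ) ^ s * #F) := key
      _ ≤ #D * ((1 + δ) * #F) := by gcongr
      _ = _ := by ring
  have h4 : (#{c : X → K | (∀ x, c x = i ↔ x ∈ W) ∧ ¬ ∃ A ∈ F, ∀ x ∈ A, c x = i ∨ c x = j} : ℝ)
      ≤ #(C \ D) := by
    gcongr
    intro c hc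
    simp only [hC, hD, mem_sdiff, mem_filter, mem_univ, true_and] at hc ⊢
    refine ⟨hc.1, fun hcD => hc.2 ?_⟩
    obtain ⟨-, A, hA, hx⟩ := hcD
    refine ⟨P A, hPF A hA, fun x hxP => ?_⟩
    by_cases hxW : x ∈ W
    · exact Or.inl ((hc.1 x).2 hxW)
    · exact Or.inr (hx x ⟨hxP, hxW⟩)
  refine h4.trans ?_
  rw [cast_card_sdiff hDC]
  -- From `h3` and `#D ≤ #C`: `(1 - δ) #C ≤ #D + δ #C`.
  nlinarith

open Finset in
/-- The union of two colour classes of a random colouring contains a member of a spread family. -/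
theorem card_misses_le {X K : Type*} [Fintype X] [DecidableEq X] [Fintype K]
    [DecidableEq K] {i j : K} (hij : i ≠ j) (F : Finset (Finset X)) (hFne : F.Nonempty) {κ δ : ℝ}
    (hκ : 0 < κ) (hδ : 0 < δ) (hF : ∀ T, (#{A ∈ F | T ⊆ A} : ℝ) * κ ^ #T ≤ #F) {t : ℕ}
    (hFt : ∀ A ∈ F, #A ≤ t) (s : ℕ)
    (h1 : (2 * Fintype.card K : ℝ) ^ t ≤ δ ^ 2 * κ ^ s)
    (h2 : (1 + Fintype.card K / κ) ^ s ≤ 1 + δ) :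
    (#{c : X → K | ¬ ∃ A ∈ F, ∀ x ∈ A, c x = i ∨ c x = j} : ℝ) ≤
      3 * δ * Fintype.card (X → K) := by
  classical
  have hF0 : (0 : ℝ) < #F := by exact_mod_cast hFne.card_pos
  let bad : (X → K) → Finset (Finset X) := fun c => {A ∈ F | ∀ A' ∈ F,
    (∀ x ∈ A', x ∉ A → c x = i) → s < #{x ∈ A' | c x ≠ i}}
  let Q : Finset (X → K) := {c | δ * #F < #(bad c)}
  -- Markov's inequality; `h1` carries `δ ^ 2` since one factor `δ` is spent here.
  have hQ : (#Q : ℝ) ≤ δ * Fintype.card (X → K) := by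
    have h := sum_card_no_small_residue_mul_pow_le F hκ hF hFt s i
    have h' : #Q * (δ * #F) ≤ ∑ c, (#(bad c) : ℝ) := by
      calc #Q * (δ * #F) = ∑ c ∈ Q, δ * (#F : ℝ) := by rw [sum_const, nsmul_eq_mul]
        _ ≤ ∑ c ∈ Q, (#(bad c) : ℝ) := sum_le_sum fun c hc => (mem_filter.1 hc).2.le
        _ ≤ _ := sum_le_sum_of_subset_of_nonneg (subset_univ _) fun _ _ _ => Nat.cast_nonneg _
    refine le_of_mul_le_mul_right ?_ (show 0 < δ * #F * κ ^ s by positivity)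
    calc #Q * (δ * #F * κ ^ s) = #Q * (δ * #F) * κ ^ s := by ring
      _ ≤ (∑ c, (#(bad c) : ℝ)) * κ ^ s := by gcongr
      _ ≤ _ := h
      _ ≤ δ ^ 2 * κ ^ s * #F * Fintype.card (X → K) := by gcongr
      _ = _ := by ring
  let M : Finset (X → K) := {c | ¬ ∃ A ∈ F, ∀ x ∈ A, c x = i ∨ c x = j}
  let w : (X → K) → Finset X := fun c => {x | c x = i}
  have hw : ∀ c W, w c = W ↔ ∀ x, c x = i ↔ x ∈ W := by
    intro c W
    simp [w, Finset.ext_iff]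
  -- `bad c` depends only on the class of `i`, so one colouring outside `Q` makes its whole fibre
  -- good.
  have hclass : ∀ W, (#{c ∈ M \ Q | w c = W} : ℝ) ≤ 2 * δ * #{c : X → K | w c = W} := by
    intro W
    rcases ({c ∈ M \ Q | w c = W} : Finset (X → K)).eq_empty_or_nonempty with he | ⟨c₀, hc₀⟩
    · rw [he]; simp; positivity
    simp only [mem_filter, mem_sdiff] at hc₀
    obtain ⟨⟨-, hcQ⟩, hcW⟩ := hc₀
    have hc₀W := (hw c₀ W).1 hcW
    have hgood : (1 - δ) * #F ≤
        #{A ∈ F | ∃ A' ∈ F, (∀ x ∈ A', x ∉ A → x ∈ W) ∧ #(A' \ W) ≤ s} := by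
      have hbad : (#(bad c₀) : ℝ) ≤ δ * #F := by
        by_contra h
        exact hcQ (mem_filter.2 ⟨mem_univ _, not_le.1 h⟩)
      have hsub : F \ bad c₀ ⊆
          {A ∈ F | ∃ A' ∈ F, (∀ x ∈ A', x ∉ A → x ∈ W) ∧ #(A' \ W) ≤ s} := by
        intro A hA
        simp only [bad, mem_sdiff, mem_filter, not_and, not_forall, not_lt] at hA
        obtain ⟨hAF, h⟩ := hA
        obtain ⟨A', hA', h3, h4⟩ := h hAF
        refine mem_filter.2 ⟨hAF, A', hA', fun x hx hxA => (hc₀W x).1 (h3 x hx hxA), ?_⟩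
        refine le_trans (card_le_card fun x hx => ?_) h4
        obtain ⟨hx1, hx2⟩ := mem_sdiff.1 hx
        exact mem_filter.2 ⟨hx1, fun h => hx2 ((hc₀W x).1 h)⟩
      refine le_trans ?_ (Nat.cast_le.2 (card_le_card hsub))
      rw [cast_card_sdiff (filter_subset _ _)]
      linarith
    have := card_class_misses_le hij F hFne hκ hδ hF s h2 W hgood
    simp only [hw]
    refine le_trans ?_ this
    gcongr
    intro c hc
    simp only [M, mem_filter, mem_sdiff, mem_univ, true_and] at hc ⊢
    exact ⟨hc.2, hc.1.1⟩
  have hsum : (#(M \ Q) : ℝ) ≤ 2 * δ * Fintype.card (X → K) := by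
    have e1 : #(M \ Q) = ∑ W, #{c ∈ M \ Q | w c = W} :=
      card_eq_sum_card_fiberwise fun _ _ => mem_coe.2 (mem_univ _)
    have e2 : Fintype.card (X → K) = ∑ W, #{c : X → K | w c = W} :=
      card_eq_sum_card_fiberwise fun _ _ => mem_coe.2 (mem_univ _)
    rw [e1, e2]
    push_cast
    rw [mul_sum]
    exact sum_le_sum fun W _ => hclass W
  have hM : #M ≤ #(M \ Q) + #Q := by
    rw [← card_sdiff_add_card_inter M Q]
    exact Nat.add_le_add_left (card_le_card inter_subset_right) _
  have hM' : (#M : ℝ) ≤ #(M \ Q) + #Q := by exact_mod_cast hM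
  change (#M : ℝ) ≤ _
  linarith

open Finset in
/-- A sufficiently spread family has `r` pairwise disjoint members. -/
theorem exists_pairwise_disjoint_of_spread {X : Type*} [Fintype X] [DecidableEq X]
    (F : Finset (Finset X)) (hFne : F.Nonempty) {κ : ℝ} {r : ℕ} (hr : 1 ≤ r)
    (hκ : 0 < κ) (hF : ∀ T, (#{A ∈ F | T ⊆ A} : ℝ) * κ ^ #T ≤ #F) {t : ℕ}
    (hFt : ∀ A ∈ F, #A ≤ t) (s : ℕ)
    (h1 : (4 * r : ℝ) ^ t * (16 * r ^ 2) ≤ κ ^ s)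
    (h2 : (1 + 2 * r / κ) ^ s ≤ 1 + 1 / (4 * r)) :
    ∃ A : Fin r → Finset X, (∀ i, A i ∈ F) ∧ ∀ i j, i ≠ j → Disjoint (A i) (A j) := by
  classical
  have hr0 : (0 : ℝ) < r := by exact_mod_cast hr
  have : Nonempty (Fin r) := ⟨⟨0, hr⟩⟩
  have hK : (Fintype.card (Fin r × Bool) : ℝ) = 2 * r := by
    simp [Fintype.card_prod]; ring
  let M : Fin r → Finset (X → Fin r × Bool) := fun i =>
    {c | ¬ ∃ A ∈ F, ∀ x ∈ A, c x = (i, false) ∨ c x = (i, true)}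
  -- With `δ = 1/(4r)` the `r` failure probabilities add up to at most 3/4.
  have hM : ∀ i, (#(M i) : ℝ) ≤ 3 * (1 / (4 * r)) * Fintype.card (X → Fin r × Bool) := by
    intro i
    refine card_misses_le (i := (i, false)) (j := (i, true)) (by simp) F hFne hκ
      (by positivity) hF hFt s ?_ ?_
    · rw [hK]
      have : (1 / (4 * r : ℝ)) ^ 2 = 1 / (16 * r ^ 2) := by field_simp; norm_num
      rw [this, one_div_mul_eq_div, le_div_iff₀ (by positivity)]
      rwa [show (2 * (2 * r) : ℝ) = 4 * r by ring]
    · rw [hK]; exact h2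
  have hQ : (0 : ℝ) < Fintype.card (X → Fin r × Bool) := by exact_mod_cast Fintype.card_pos
  have hlt : #(univ.biUnion M) < #(univ : Finset (X → Fin r × Bool)) := by
    have : (#(univ.biUnion M) : ℝ) ≤ ∑ i, (#(M i) : ℝ) := by exact_mod_cast card_biUnion_le
    have h3 : (#(univ.biUnion M) : ℝ) < Fintype.card (X → Fin r × Bool) := by
      calc _ ≤ ∑ i, (#(M i) : ℝ) := this
        _ ≤ ∑ i : Fin r, 3 * (1 / (4 * r)) * (Fintype.card (X → Fin r × Bool) : ℝ) :=
            sum_le_sum fun i _ => hM i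
        _ = 3 / 4 * (Fintype.card (X → Fin r × Bool) : ℝ) := by
            rw [sum_const, card_univ, Fintype.card_fin, nsmul_eq_mul]; field_simp
        _ < _ := by linarith
    rw [card_univ]
    exact_mod_cast h3
  obtain ⟨c, -, hc⟩ := exists_mem_notMem_of_card_lt_card hlt
  simp only [M, mem_biUnion, mem_univ, true_and, mem_filter, not_exists] at hc
  have hc' : ∀ i, ∃ A ∈ F, ∀ x ∈ A, c x = (i, false) ∨ c x = (i, true) := fun i =>
    not_not.1 fun h => hc i (by simpa using h)
  choose A hAF hA using hc'
  refine ⟨A, hAF, fun i j hij => disjoint_left.2 fun x hxi hxj => hij ?_⟩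
  rcases hA i x hxi with h | h <;> rcases hA j x hxj with h' | h' <;>
    simpa using congrArg Prod.fst (h.symm.trans h')

/-! ### Sunflowers in uniform families -/

open Finset in
/-- A uniform family with more than `κ ^ t` members contains a sunflower with `r` petals, as soon
as `κ`-spread families have `r` disjoint members. -/
theorem exists_sunflower_of_pow_lt_card {X : Type*} [Fintype X] [DecidableEq X]
    (F : Finset (Finset X)) {κ : ℝ} {r : ℕ} (hr : 1 ≤ r) (hκ : 0 < κ) {t : ℕ}
    (hFt : ∀ A ∈ F, #A = t) (s : ℕ)
    (h1 : (4 * r : ℝ) ^ t * (16 * r ^ 2) ≤ κ ^ s)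
    (h2 : (1 + 2 * r / κ) ^ s ≤ 1 + 1 / (4 * r)) (hcard : κ ^ t < #F) :
    ∃ (S : Finset X) (A : Fin r → Finset X), (∀ i, A i ∈ F ∧ S ⊂ A i) ∧
      ∀ i j, i ≠ j → Disjoint (A i \ S) (A j \ S) := by
  classical
  -- Maximality of this weight at `S` is exactly `κ`-spreadness of the link of `S`.
  obtain ⟨S, -, hS⟩ := exists_max_image (univ : Finset (Finset X))
    (fun S => (#{A ∈ F | S ⊆ A} : ℝ) * κ ^ #S) univ_nonempty
  replace hS : ∀ T, (#{A ∈ F | T ⊆ A} : ℝ) * κ ^ #T ≤ #{A ∈ F | S ⊆ A} * κ ^ #S :=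
    fun T => hS T (mem_univ T)
  have hS0 : (#F : ℝ) ≤ #{A ∈ F | S ⊆ A} * κ ^ #S := by simpa using hS ∅
  set FS : Finset (Finset X) := {A ∈ F | S ⊆ A} with hFS
  have hFSne : FS.Nonempty := by
    rw [nonempty_iff_ne_empty]
    intro h
    rw [h] at hS0
    simp only [card_empty, Nat.cast_zero, zero_mul] at hS0
    linarith [pow_pos hκ t]
  have hinj : Set.InjOn (fun A => A \ S) (FS : Set (Finset X)) := by
    intro A hA B hB hAB
    have hA' := (mem_filter.1 (mem_coe.1 hA)).2
    have hB' := (mem_filter.1 (mem_coe.1 hB)).2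
    rw [← sdiff_union_of_subset hA', ← sdiff_union_of_subset hB']
    exact congrArg (· ∪ S) hAB
  set Lk := FS.image (fun A => A \ S) with hLk
  have hLcard : #Lk = #FS := card_image_of_injOn hinj
  have hLF : ∀ T, (#{B ∈ Lk | T ⊆ B} : ℝ) * κ ^ #T ≤ #Lk := by
    intro T
    rcases ({B ∈ Lk | T ⊆ B} : Finset (Finset X)).eq_empty_or_nonempty with he | ⟨B, hB⟩
    · rw [he]; simp
    have hTS : Disjoint S T := by
      obtain ⟨hB1, hB2⟩ := mem_filter.1 hB
      obtain ⟨A, -, rfl⟩ := mem_image.1 hB1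
      exact disjoint_of_subset_right hB2 disjoint_sdiff
    have hle : #{B ∈ Lk | T ⊆ B} ≤ #{A ∈ F | S ∪ T ⊆ A} := by
      refine (card_le_card ?_).trans
        (card_image_le (f := fun A => A \ S) (s := {A ∈ F | S ∪ T ⊆ A}))
      intro B hB
      obtain ⟨hB1, hB2⟩ := mem_filter.1 hB
      obtain ⟨A, hA, rfl⟩ := mem_image.1 hB1
      obtain ⟨hA1, hA2⟩ := mem_filter.1 hA
      exact mem_image.2 ⟨A, mem_filter.2 ⟨hA1, union_subset hA2 (hB2.trans sdiff_subset)⟩, rfl⟩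
    have h3 := hS (S ∪ T)
    rw [card_union_of_disjoint hTS, pow_add] at h3
    refine le_of_mul_le_mul_right ?_ (pow_pos hκ #S)
    rw [hLcard]
    calc _ ≤ (#{A ∈ F | S ∪ T ⊆ A} : ℝ) * κ ^ #T * κ ^ #S := by gcongr
      _ = #{A ∈ F | S ∪ T ⊆ A} * (κ ^ #S * κ ^ #T) := by ring
      _ ≤ _ := h3
  obtain ⟨B, hBL, hB⟩ := exists_pairwise_disjoint_of_spread Lk (hFSne.image _) hr hκ hLF (t := t)
    (fun B hB => by
      obtain ⟨A, hA, rfl⟩ := mem_image.1 hB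
      exact (card_le_card sdiff_subset).trans (hFt A (mem_filter.1 hA).1).le) s h1 h2
  have hBA : ∀ i, ∃ A ∈ FS, A \ S = B i := fun i => mem_image.1 (hBL i)
  choose A hA hAB using hBA
  refine ⟨S, A, fun i => ?_, fun i j hij => by rw [hAB, hAB]; exact hB i j hij⟩
  obtain ⟨hAF, hSA⟩ := mem_filter.1 (hA i)
  refine ⟨hAF, hSA.ssubset_of_ne ?_⟩
  -- A core equal to a member would have `t` points and be the only member above itself, with weight
  -- at most `κ ^ t < #F`, against maximality.
  rintro hSe
  have hFSs : #FS ≤ 1 := by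
    refine card_le_one.2 fun C hC D hD => ?_
    obtain ⟨hC1, hC2⟩ := mem_filter.1 hC
    obtain ⟨hD1, hD2⟩ := mem_filter.1 hD
    have hSt : #S = t := hSe ▸ hFt _ hAF
    rw [← eq_of_subset_of_card_le hC2 (by rw [hFt C hC1, hSt]),
      ← eq_of_subset_of_card_le hD2 (by rw [hFt D hD1, hSt])]
  have hSt : #S = t := hSe ▸ hFt _ hAF
  have : (#FS : ℝ) ≤ 1 := by exact_mod_cast hFSs
  rw [hSt] at hS0
  nlinarith [pow_pos hκ t]

/-! ### Choice of the spread parameter -/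

open Filter in
/-- The parameters for which `t / √(log t)`-spread families of `t`-sets have `r` disjoint
members. -/
theorem eventually_exists_residue_bound {r : ℕ} (hr : 1 ≤ r) :
    ∀ᶠ t : ℕ in atTop, 0 < (t : ℝ) / √(Real.log t) ∧ ∃ s : ℕ,
      (4 * r : ℝ) ^ t * (16 * r ^ 2) ≤ ((t : ℝ) / √(Real.log t)) ^ s ∧
      (1 + 2 * r / ((t : ℝ) / √(Real.log t))) ^ s ≤ 1 + 1 / (4 * r) := by
  have hr0 : (1 : ℝ) ≤ r := by exact_mod_cast hr
  set a : ℝ := 4 * Real.log (4 * r) with ha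
  have ha0 : 0 ≤ a := mul_nonneg (by norm_num) (Real.log_nonneg (by linarith))
  set ε : ℝ := Real.log (1 + 1 / (4 * r)) with hε
  have hε0 : 0 < ε := Real.log_pos (by linarith [show (0 : ℝ) < 1 / (4 * r) by positivity])
  have hlog : Tendsto (fun t : ℕ => √(Real.log t)) atTop atTop :=
    Real.tendsto_sqrt_atTop.comp (Real.tendsto_log_atTop.comp tendsto_natCast_atTop_atTop)
  filter_upwards [hlog.eventually_ge_atTop (2 * r * (a + 1) / ε), hlog.eventually_ge_atTop 1,
    eventually_ge_atTop 2] with t h1 h2 ht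
  have ht0 : (0 : ℝ) < t := by positivity
  have ht1 : (1 : ℝ) ≤ t := by exact_mod_cast (by omega : 1 ≤ t)
  set ℓ := √(Real.log t) with hℓ
  have hL0 : 0 ≤ Real.log t := Real.log_nonneg ht1
  have hℓ2 : ℓ * ℓ = Real.log t := Real.mul_self_sqrt hL0
  have hℓ0 : 0 < ℓ := by linarith
  have hLt : Real.log t ≤ t := (Real.log_le_sub_one_of_pos ht0).trans (by linarith)
  have hL1 : 0 < Real.log t := by rw [← hℓ2]; positivity
  have hκ : 0 < (t : ℝ) / ℓ := by positivity
  have hκt : √t ≤ (t : ℝ) / ℓ := by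
    rw [le_div_iff₀ hℓ0]
    calc √t * ℓ ≤ √t * √t := by gcongr; exact Real.sqrt_le_sqrt hLt
      _ = t := Real.mul_self_sqrt ht0.le
  -- Since `κ ≥ √t`, this `s` gives `κ ^ s ≥ t ^ (s / 2) ≥ (4r) ^ (2t)`, whereas `s / κ` is at most
  -- `(a + 1) / √(log t)`, which tends to 0.
  refine ⟨hκ, ⌈a * t / Real.log t⌉₊, ?_, ?_⟩
  · have h3 : (16 * r ^ 2 : ℝ) ≤ (4 * r) ^ t := by
      calc (16 * r ^ 2 : ℝ) = (4 * r) ^ 2 := by ring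
        _ ≤ _ := pow_le_pow_right₀ (by linarith) ht
    have h4 : Real.log t / 2 ≤ Real.log (t / ℓ) := by
      rw [← Real.log_sqrt ht0.le]
      exact Real.log_le_log (Real.sqrt_pos.2 ht0) hκt
    calc (4 * r : ℝ) ^ t * (16 * r ^ 2) ≤ (4 * r) ^ t * (4 * r) ^ t := by gcongr
      _ = (4 * r) ^ (2 * t) := by ring
      _ ≤ _ := by
        rw [← Real.log_le_log_iff (by positivity) (by positivity), Real.log_pow, Real.log_pow]
        have h5 := Nat.le_ceil (a * t / Real.log t)
        rw [div_le_iff₀ hL1] at h5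
        have h6 : (⌈a * t / Real.log t⌉₊ : ℝ) * (Real.log t / 2) ≤
            ⌈a * t / Real.log t⌉₊ * Real.log (t / ℓ) := by gcongr
        refine le_trans ?_ h6
        push_cast
        rw [ha] at h5
        linarith
  · have h3 : (⌈a * t / Real.log t⌉₊ : ℝ) ≤ (a + 1) * t / Real.log t := by
      refine (Nat.ceil_lt_add_one (by positivity)).le.trans ?_
      rw [div_add' _ _ _ hL1.ne']
      gcongr
      linarith
    calc (1 + 2 * r / ((t : ℝ) / ℓ)) ^ ⌈a * t / Real.log t⌉₊
        ≤ Real.exp (2 * r / ((t : ℝ) / ℓ)) ^ ⌈a * t / Real.log t⌉₊ := by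
          gcongr
          rw [add_comm]
          exact Real.add_one_le_exp _
      _ = Real.exp (⌈a * t / Real.log t⌉₊ * (2 * r / ((t : ℝ) / ℓ))) := by
          rw [← Real.exp_nat_mul]
      _ ≤ Real.exp ε := by
          rw [Real.exp_le_exp]
          calc _ ≤ (a + 1) * t / Real.log t * (2 * r / ((t : ℝ) / ℓ)) := by gcongr
            _ = 2 * r * (a + 1) / ℓ := by rw [← hℓ2]; field_simp
            _ ≤ ε := by
              rw [div_le_iff₀ hε0] at h1
              rw [div_le_iff₀ hℓ0]
              linarith
      _ = _ := Real.exp_log (by positivity)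

/-! ### Counting matchings with a given vertex set -/

open Finset in
/-- Greedy lower bound for the number of `i`-element independent sets of a conflict relation in
which every element conflicts with at most `D` elements. -/
theorem choose_mul_pow_le_card_independent {X : Type*} [Fintype X] [DecidableEq X]
    (compat : X → X → Prop) [DecidableRel compat] (hsymm : ∀ x y, compat x y → compat y x)
    (hirr : ∀ x, ¬ compat x x) {D t : ℕ} (hD : ∀ x, #{y | ¬ compat x y} ≤ D)
    (ht : t * D ≤ Fintype.card X) (i : ℕ) (hi : i ≤ t) :
    t.choose i * D ^ i ≤ #{A : Finset X | #A = i ∧ ∀ x ∈ A, ∀ y ∈ A, x ≠ y → compat x y} := by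
  induction i with
  | zero =>
    simp only [Nat.choose_zero_right, pow_zero, mul_one]
    exact card_pos.2 ⟨∅, by simp⟩
  | succ i ih =>
    specialize ih (by omega)
    -- Double count inclusions: an independent `i`-set has at least `(t - i) * D` extensions by one
    -- element, and an `(i + 1)`-set contains `i + 1` sets of size `i`.
    have hstep := card_mul_le_card_mul (fun A B : Finset X => A ⊆ B)
      (s := {A : Finset X | #A = i ∧ ∀ x ∈ A, ∀ y ∈ A, x ≠ y → compat x y})
      (t := {A : Finset X | #A = i + 1 ∧ ∀ x ∈ A, ∀ y ∈ A, x ≠ y → compat x y})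
      (m := (t - i) * D) (n := i + 1) (by
        intro A hA
        simp only [mem_filter, mem_univ, true_and] at hA
        obtain ⟨hAi, hA⟩ := hA
        let N : Finset X := A.biUnion fun x => {y | ¬ compat x y}
        have hN : #N ≤ i * D := hAi ▸ card_biUnion_le_card_mul _ _ _ fun x _ => hD x
        have hAN : ∀ y, y ∉ N → ∀ x ∈ A, compat x y := by
          intro y hy x hx
          by_contra h
          exact hy (mem_biUnion.2 ⟨x, hx, by simpa using h⟩)
        have hNA : ∀ y, y ∉ N → y ∉ A := fun y hy hyA => hirr y (hAN y hy y hyA)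
        calc (t - i) * D ≤ #Nᶜ := by
              rw [card_compl, Nat.sub_mul]; omega
          _ = #(Nᶜ.image fun y => insert y A) := by
              refine (card_image_of_injOn fun y hy z hz hyz => ?_).symm
              have hy' := hNA y (mem_compl.1 (mem_coe.1 hy))
              have : y ∈ insert z A := hyz ▸ mem_insert_self y A
              exact (mem_insert.1 this).resolve_right hy'
          _ ≤ _ := by
              refine card_le_card fun B hB => ?_
              obtain ⟨y, hy, rfl⟩ := mem_image.1 hB
              rw [mem_compl] at hy
              simp only [mem_bipartiteAbove, mem_filter, mem_univ, true_and]
              refine ⟨⟨by rw [card_insert_of_notMem (hNA y hy), hAi], ?_⟩, subset_insert _ _⟩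
              intro x hx z hz hxz
              rcases mem_insert.1 hx with rfl | hx' <;> rcases mem_insert.1 hz with rfl | hz'
              · exact absurd rfl hxz
              · exact hsymm _ _ (hAN _ hy z hz')
              · exact hAN _ hy x hx'
              · exact hA x hx' z hz' hxz) (by
        intro B hB
        simp only [mem_filter, mem_univ, true_and] at hB
        calc _ ≤ #(B.powersetCard i) := by
              refine card_le_card fun A hA => ?_
              simp only [mem_bipartiteBelow, mem_filter, mem_univ, true_and] at hA
              exact mem_powersetCard.2 ⟨hA.2, hA.1.1⟩
          _ = i + 1 := by rw [card_powersetCard, hB.1, Nat.choose_succ_self_right])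
    refine Nat.le_of_mul_le_mul_right (le_trans ?_ hstep) i.succ_pos
    calc t.choose (i + 1) * D ^ (i + 1) * i.succ
        = t.choose (i + 1) * (i + 1) * D ^ (i + 1) := by rw [Nat.succ_eq_add_one]; ring
      _ = (t.choose i * D ^ i) * ((t - i) * D) := by rw [Nat.choose_succ_right_eq]; ring
      _ ≤ _ := by gcongr

/-- `r` matchings with the same vertex set that form a sunflower give an `r`-regular subgraph. -/
theorem hasRegularSubgraph_of_sunflower {α : Type*} [DecidableEq α] (H : Hypergraph α)
    [DecidableEq H.edgeSet] {r : ℕ} (hr : 1 ≤ r) (v : H.edgeSet → Finset α)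
    (hv : ∀ e, (v e : Set α) = e) (hne : ∀ e, (v e).Nonempty) (S : Finset H.edgeSet)
    (A : Fin r → Finset H.edgeSet)
    (hA : ∀ i, ∀ e ∈ A i, ∀ f ∈ A i, e ≠ f → Disjoint (v e) (v f))
    (hU : ∀ i j, (A i).biUnion v = (A j).biUnion v) (hS : ∀ i, S ⊂ A i)
    (hdisj : ∀ i j, i ≠ j → Disjoint (A i \ S) (A j \ S)) : H.HasRegularSubgraph r := by
  have hmem : ∀ x e, x ∈ v e ↔ x ∈ (e : Set α) := fun x e => by rw [← hv e, Finset.mem_coe]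
  let T : Set (Set α) := {e | ∃ f : H.edgeSet, (∃ i, f ∈ A i \ S) ∧ (f : Set α) = e}
  have hTH : T ⊆ H.edgeSet := by
    rintro _ ⟨f, -, rfl⟩; exact f.2
  refine ⟨T, hTH, {x | ∃ e ∈ T, x ∈ e}, ?_, ?_, ?_, ?_⟩
  · rintro x ⟨e, he, hx⟩
    exact H.subset_vertexSet_of_mem_edgeSet (hTH he) hx
  · obtain ⟨f, hf, hfS⟩ := Finset.exists_of_ssubset (hS ⟨0, hr⟩)
    obtain ⟨x, hx⟩ := hne f
    exact ⟨x, f, ⟨f, ⟨⟨0, hr⟩, Finset.mem_sdiff.2 ⟨hf, hfS⟩⟩, rfl⟩, (hmem x f).1 hx⟩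
  · rintro x ⟨_, ⟨f, ⟨i, hf⟩, rfl⟩, hx⟩
    obtain ⟨hfA, hfS⟩ := Finset.mem_sdiff.1 hf
    rw [← hmem] at hx
    -- The edge of `A j` at `x` is not in the core: otherwise it would lie in `A i` as well, where
    -- the edge at `x` is the petal edge `f`.
    have hex : ∀ j, ∃ g ∈ A j \ S, x ∈ v g := by
      intro j
      have : x ∈ (A j).biUnion v := by
        rw [hU j i]; exact Finset.mem_biUnion.2 ⟨f, hfA, hx⟩
      obtain ⟨g, hg, hxg⟩ := Finset.mem_biUnion.1 this
      refine ⟨g, Finset.mem_sdiff.2 ⟨hg, fun hgS => ?_⟩, hxg⟩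
      by_cases hgf : g = f
      · exact hfS (hgf ▸ hgS)
      · exact Finset.disjoint_left.1 (hA i g ((hS i).1 hgS) f hfA hgf) hxg hx
    choose g hg hxg using hex
    have hginj : Function.Injective fun j => (g j : Set α) := by
      intro j k hjk
      by_contra hne
      have hjk' : g j = g k := Subtype.ext hjk
      exact Finset.disjoint_left.1 (hdisj j k hne) (hg j) (hjk' ▸ hg k)
    have hset : {e | e ∈ T ∧ x ∈ e} = (fun j => (g j : Set α)) '' Set.univ := by
      ext e
      simp only [Set.mem_ofPred_eq, Set.image_univ, Set.mem_range]
      constructor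
      · rintro ⟨⟨f', ⟨j, hf'⟩, rfl⟩, hxf'⟩
        rw [← hmem] at hxf'
        refine ⟨j, ?_⟩
        by_contra h
        exact Finset.disjoint_left.1 (hA j (g j) (Finset.mem_sdiff.1 (hg j)).1 f'
          (Finset.mem_sdiff.1 hf').1 fun h' => h (congrArg _ h')) (hxg j) hxf'
      · rintro ⟨j, rfl⟩
        exact ⟨⟨g j, ⟨j, hg j⟩, rfl⟩, (hmem x _).1 (hxg j)⟩
    rw [hset, Set.ncard_image_of_injective _ hginj, Set.ncard_univ, Nat.card_fin]
  · intro x hx e he hxe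
    exact hx ⟨e, he, hxe⟩

open Finset in
/-- Counting matchings of size `t` by their vertex sets. -/
theorem pow_le_choose_mul_of_not_hasRegularSubgraph {α : Type*} (H : Hypergraph α) {k r t : ℕ}
    (hr : 1 ≤ r) (hk : 2 ≤ k) (hV : H.vertexSet.Finite) (hH : H.IsUniform k)
    (hreg : ¬ H.HasRegularSubgraph r)
    (ht : t * (k * H.maxDegree) ≤ H.edgeSet.ncard) {κ : ℝ} (hκ : 0 < κ) (s : ℕ)
    (h1 : (4 * r : ℝ) ^ t * (16 * r ^ 2) ≤ κ ^ s)
    (h2 : (1 + 2 * r / κ) ^ s ≤ 1 + 1 / (4 * r)) :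
    ((k * H.maxDegree : ℕ) : ℝ) ^ t ≤ H.vertexSet.ncard.choose (k * t) * κ ^ t := by
  classical
  have hEfin : H.edgeSet.Finite := hV.powerset.subset fun e he =>
    H.subset_vertexSet_of_mem_edgeSet he
  have : Fintype H.edgeSet := hEfin.fintype
  let v : H.edgeSet → Finset α := fun e => (hH e e.2).1.toFinset
  have hv : ∀ e, (v e : Set α) = e := fun e => Set.Finite.coe_toFinset _
  have hvk : ∀ e, #(v e) = k := fun e => by
    rw [← (hH e e.2).2, ← Set.ncard_coe_finset, hv]
  have hne : ∀ e, (v e).Nonempty := fun e => card_pos.1 (by rw [hvk]; omega)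
  have hvV : ∀ e, v e ⊆ hV.toFinset := fun e x hx => by
    rw [Set.Finite.mem_toFinset]
    exact H.subset_vertexSet_of_mem_edgeSet e.2 (by rw [← hv e]; exact hx)
  have hdeg : ∀ x ∈ H.vertexSet, #{f : H.edgeSet | x ∈ v f} ≤ H.maxDegree := by
    intro x hx
    have h3 : H.degree x ≤ H.maxDegree := le_csSup (hV.image _).bddAbove ⟨x, hx, rfl⟩
    refine le_trans ?_ h3
    rw [Hypergraph.degree, ← card_image_of_injective _ Subtype.val_injective,
      ← Set.ncard_coe_finset]
    refine Set.ncard_le_ncard ?_ (hEfin.subset fun e he => he.1)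
    intro e he
    obtain ⟨f, hf, rfl⟩ := mem_image.1 (mem_coe.1 he)
    refine ⟨f.2, ?_⟩
    rw [← hv f]
    simpa using hf
  have hconf : ∀ e, #{f : H.edgeSet | ¬ Disjoint (v e) (v f)} ≤ k * H.maxDegree := by
    intro e
    rw [← hvk e]
    refine (card_le_card (t := (v e).biUnion fun x => {f : H.edgeSet | x ∈ v f}) ?_).trans
      (card_biUnion_le_card_mul _ _ _ fun x hx => hdeg x ?_)
    · intro f hf
      simp only [mem_filter, mem_univ, true_and, not_disjoint_iff] at hf
      obtain ⟨x, hx, hxf⟩ := hf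
      exact mem_biUnion.2 ⟨x, hx, by simpa using hxf⟩
    · exact hV.mem_toFinset.1 (hvV e hx)
  let M : Finset (Finset H.edgeSet) :=
    {A | #A = t ∧ ∀ e ∈ A, ∀ f ∈ A, e ≠ f → Disjoint (v e) (v f)}
  have hM : (k * H.maxDegree) ^ t ≤ #M := by
    have := choose_mul_pow_le_card_independent (fun e f : H.edgeSet => Disjoint (v e) (v f))
      (fun e f h => h.symm) (fun e h => (hne e).ne_empty (disjoint_self.1 h)) hconf
      (t := t) (by rwa [← Nat.card_eq_fintype_card, Nat.card_coe_set_eq]) t le_rfl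
    simpa [M] using this
  have hmaps : ∀ A ∈ M, A.biUnion v ∈ hV.toFinset.powersetCard (k * t) := by
    intro A hA
    simp only [M, mem_filter, mem_univ, true_and] at hA
    refine mem_powersetCard.2 ⟨biUnion_subset.2 fun e _ => hvV e, ?_⟩
    rw [card_biUnion fun e he f hf hef => hA.2 e he f hf hef, sum_congr rfl fun e _ => hvk e,
      sum_const, hA.1, smul_eq_mul, mul_comm]
  have hfib : ∀ U, (#{A ∈ M | A.biUnion v = U} : ℝ) ≤ κ ^ t := by
    intro U
    by_contra! hlt
    obtain ⟨S, A, hA, hd⟩ := exists_sunflower_of_pow_lt_card {A ∈ M | A.biUnion v = U} hr hκ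
      (fun A hA => by
        simp only [M, mem_filter, mem_univ, true_and] at hA
        exact hA.1.1) s h1 h2 hlt
    simp only [M, mem_filter, mem_univ, true_and] at hA
    exact hreg (hasRegularSubgraph_of_sunflower H hr v hv hne S A (fun i => (hA i).1.1.2)
      (fun i j => (hA i).1.2.trans (hA j).1.2.symm) (fun i => (hA i).2) hd)
  have hsum : (#M : ℝ) =
      ∑ U ∈ hV.toFinset.powersetCard (k * t), (#{A ∈ M | A.biUnion v = U} : ℝ) := by
    exact_mod_cast card_eq_sum_card_fiberwise hmaps
  calc ((k * H.maxDegree : ℕ) : ℝ) ^ t ≤ #M := by exact_mod_cast hM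
    _ ≤ ∑ U ∈ hV.toFinset.powersetCard (k * t), κ ^ t := by
        rw [hsum]; exact sum_le_sum fun U _ => hfib U
    _ = _ := by
        rw [sum_const, card_powersetCard, nsmul_eq_mul, Set.ncard_eq_toFinset_card _ hV]

/-! ### Numerical estimates -/

/-- Passing to `t`-th roots in the count of matchings of size `t`. -/
theorem le_of_pow_le_choose_mul {n k t : ℕ} (hk : 1 ≤ k) (ht : 1 ≤ t) {D κ : ℝ} (hκ : 0 ≤ κ)
    (h : D ^ t ≤ n.choose (k * t) * κ ^ t) :
    D ≤ (Real.exp 1 * n / (k * t)) ^ k * κ := by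
  have hj : (0 : ℝ) < (k * t : ℕ) := by exact_mod_cast Nat.mul_pos hk ht
  have hc : (n.choose (k * t) : ℝ) ≤ (Real.exp 1 * n / (k * t)) ^ (k * t) := by
    have h1 : (n.choose (k * t) : ℝ) ≤ n ^ (k * t) / (k * t).factorial :=
      Nat.choose_le_pow_div (k * t) n
    have h2 := Real.pow_div_factorial_le_exp ((k * t : ℕ) : ℝ) hj.le (k * t)
    have h3 : Real.exp ((k * t : ℕ) : ℝ) = Real.exp 1 ^ (k * t) := by
      rw [← Real.exp_nat_mul, mul_one]
    rw [h3, div_le_iff₀ (by positivity)] at h2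
    refine h1.trans ?_
    have hf : (0 : ℝ) < (k * t).factorial := by positivity
    rw [div_pow, mul_pow, div_le_div_iff₀ hf (by positivity)]
    calc (n : ℝ) ^ (k * t) * (k * t) ^ (k * t)
        ≤ n ^ (k * t) * (Real.exp 1 ^ (k * t) * (k * t).factorial) := by
          gcongr
          exact_mod_cast h2
      _ = _ := by ring
  refine le_of_pow_le_pow_left₀ (by omega : t ≠ 0) (by positivity) (h.trans ?_)
  rw [mul_pow, ← pow_mul]
  gcongr

/-- The numerical form of the edge bound, before taking `(k - 1)`-st roots; here `k = j + 2`. -/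
theorem pow_mul_sqrt_le {j n Δ t : ℕ} {m ℓ : ℝ} (hΔ : 0 < Δ) (ht : 0 < t) (hm : 0 ≤ m)
    (hmt : 2 / 3 * (m / ((j + 2 : ℕ) * Δ)) ≤ t) {L : ℝ} (hL : 0 < L) (hℓL : ℓ ≤ L)
    (h : ((j + 2 : ℕ) * Δ : ℝ) ≤ (Real.exp 1 * n / ((j + 2 : ℕ) * t)) ^ (j + 2) * (t / √L)) :
    m ^ (j + 1) * √ℓ ≤ 6 ^ (j + 1) * n ^ (j + 2) * Δ ^ j := by
  set k : ℝ := ((j + 2 : ℕ) : ℝ) with hk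
  have hk2 : (2 : ℝ) ≤ k := by rw [hk]; push_cast; linarith [(Nat.cast_nonneg j : (0 : ℝ) ≤ j)]
  have hΔ0 : (0 : ℝ) < Δ := by exact_mod_cast hΔ
  have ht0 : (0 : ℝ) < t := by exact_mod_cast ht
  have hL0 : 0 < √L := Real.sqrt_pos.2 hL
  have h1 : k * Δ * √L * (k * t) ^ (j + 1) * k ≤ (Real.exp 1 * n) ^ (j + 2) := by
    rw [div_pow, div_mul_div_comm, le_div_iff₀ (by positivity)] at h
    refine le_of_mul_le_mul_right ?_ ht0
    calc _ = k * Δ * ((k * t) ^ (j + 2) * √L) := by ring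
      _ ≤ _ := h
  have h2 : 2 / 3 * (m / Δ) ≤ k * t := by
    calc 2 / 3 * (m / Δ) = k * (2 / 3 * (m / (k * Δ))) := by field_simp
      _ ≤ _ := by gcongr
  have h3 : k * Δ * √ℓ * (2 / 3 * (m / Δ)) ^ (j + 1) * k ≤ (Real.exp 1 * n) ^ (j + 2) := by
    refine le_trans ?_ h1
    gcongr
  have h4 : m ^ (j + 1) * √ℓ * k ^ 2 ≤
      (3 / 2 * Real.exp 1) ^ (j + 1) * Real.exp 1 * n ^ (j + 2) * Δ ^ j := by
    have e1 : k * Δ * √ℓ * (2 / 3 * (m / Δ)) ^ (j + 1) * k * ((3 / 2) ^ (j + 1) * Δ ^ j) =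
        m ^ (j + 1) * √ℓ * k ^ 2 := by
      have e2 : (2 / 3 : ℝ) ^ (j + 1) * (3 / 2) ^ (j + 1) = 1 := by
        rw [← mul_pow]; norm_num
      have e3 : (m / Δ) ^ (j + 1) * (Δ * Δ ^ j) = m ^ (j + 1) := by
        rw [← pow_succ', ← mul_pow, div_mul_cancel₀ _ hΔ0.ne']
      calc _ = ((2 / 3 : ℝ) ^ (j + 1) * (3 / 2) ^ (j + 1)) *
            ((m / Δ) ^ (j + 1) * (Δ * Δ ^ j)) * √ℓ * k ^ 2 := by rw [mul_pow]; ring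
        _ = _ := by rw [e2, e3]; ring
    rw [← e1]
    calc _ ≤ (Real.exp 1 * n) ^ (j + 2) * ((3 / 2) ^ (j + 1) * Δ ^ j) := by gcongr
      _ = _ := by ring
  have he : Real.exp 1 < 2.7182818286 := Real.exp_one_lt_d9
  -- The constant 6 has room to spare, as `3e/2 < 4.1`; the leftover factor `e` is absorbed by `k ^
  -- 2 ≥ 4`.
  have h5 : (3 / 2 * Real.exp 1) ^ (j + 1) ≤ 6 ^ (j + 1) := by
    gcongr
    linarith
  have h6 : Real.exp 1 ≤ k ^ 2 := by nlinarith
  refine le_of_mul_le_mul_right ?_ (show 0 < k ^ 2 by positivity)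
  calc _ ≤ _ := h4
    _ ≤ 6 ^ (j + 1) * k ^ 2 * n ^ (j + 2) * Δ ^ j := by gcongr
    _ = _ := by ring

open Filter in
/-- The iterated binary logarithm is eventually below `log (2 x / 3)`. -/
theorem eventually_logb_logb_le_log :
    ∀ᶠ x : ℝ in atTop, Real.logb 2 (Real.logb 2 x) ≤ Real.log (2 / 3 * x) := by
  have hl2 : 0 < Real.log 2 := Real.log_pos (by norm_num)
  -- At `y = logb 2 x` the slope 1/4 gives about `0.53 * log x` after both divisions by `log 2`,
  -- leaving room for `log (2/3)`.
  have h : ∀ᶠ y : ℝ in atTop, Real.log y ≤ 1 / 4 * y := by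
    filter_upwards [Real.isLittleO_log_id_atTop.bound (show (0 : ℝ) < 1 / 4 by norm_num),
      eventually_ge_atTop 1] with y hy hy1
    have := (le_abs_self _).trans hy
    rwa [id, Real.norm_of_nonneg (by linarith)] at this
  have hT : Tendsto (fun x : ℝ => Real.logb 2 x) atTop atTop :=
    Real.tendsto_logb_atTop (by norm_num)
  filter_upwards [hT.eventually h, Real.tendsto_log_atTop.eventually_ge_atTop 2,
    eventually_gt_atTop 0] with x h1 h2 hx
  have h3 : Real.log (2 / 3 * x) = Real.log (2 / 3) + Real.log x :=
    Real.log_mul (by norm_num) hx.ne'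
  have h4 : -(1 / 2 : ℝ) ≤ Real.log (2 / 3) := by
    have := Real.one_sub_inv_le_log_of_pos (show (0 : ℝ) < 2 / 3 by norm_num)
    norm_num at this ⊢
    linarith
  have h5 : (0.69 : ℝ) < Real.log 2 := by linarith [Real.log_two_gt_d9]
  rw [h3]
  calc Real.logb 2 (Real.logb 2 x) = Real.log (Real.logb 2 x) / Real.log 2 := rfl
    _ ≤ 1 / 4 * (Real.log x / Real.log 2) / Real.log 2 := by
      gcongr
      exact h1
    _ = Real.log x / (4 * (Real.log 2 * Real.log 2)) := by field_simp
    _ ≤ Real.log x / (4 * (0.69 * 0.69)) := by gcongr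
    _ ≤ _ := by norm_num; linarith

/-! ### Assembling the bound -/

theorem lemma2p7 (r : ℕ) (hr : 1 ≤ r) :
    ∃ c : ℝ, 2 < c ∧
      ∀ (α : Type*) (H : Hypergraph α) (n k Δ : ℕ),
        2 ≤ k →
        H.vertexSet.Finite →
        H.vertexSet.ncard = n →
        H.edgeSet.Nonempty →
        H.IsUniform k →
        ¬ H.HasRegularSubgraph r →
        H.maxDegree = Δ →
        c * k * Δ ≤ (H.edgeSet.ncard : ℝ) →
        (H.edgeSet.ncard : ℝ) ≤
          6 * (n : ℝ) ^ ((k : ℝ) / ((k : ℝ) - 1)) *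
              (Δ : ℝ) ^ (((k : ℝ) - 2) / ((k : ℝ) - 1)) /
            (Real.logb 2 (Real.logb 2 ((H.edgeSet.ncard : ℝ) / ((k : ℝ) * (Δ : ℝ))))) ^
              ((1 : ℝ) / (2 * ((k : ℝ) - 1))) := by
  obtain ⟨t₀, ht₀⟩ := Filter.eventually_atTop.1 (eventually_exists_residue_bound hr)
  obtain ⟨x₀, hx₀⟩ := Filter.eventually_atTop.1 eventually_logb_logb_le_log
  -- `t₀ + 1` allows for the floor in `t`; 5 makes the iterated logarithm positive and gives `2x/3 ≤
  -- x - 1 < t`.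
  refine ⟨max x₀ (max (t₀ + 1) 5), lt_max_of_lt_right (lt_max_of_lt_right (by norm_num)), ?_⟩
  rintro α H n k Δ hk hV rfl hE hH hreg hΔ hc
  obtain ⟨j, rfl⟩ : ∃ j, k = j + 2 := ⟨k - 2, by omega⟩
  have hΔ0 : 0 < Δ := by
    obtain ⟨e, he⟩ := hE
    obtain ⟨x, hx⟩ := (Set.ncard_pos (hH e he).1).1 (by rw [(hH e he).2]; omega)
    have hEfin : H.edgeSet.Finite := hV.powerset.subset fun e he =>
      H.subset_vertexSet_of_mem_edgeSet he
    have h1 : H.degree x ≤ H.maxDegree :=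
      le_csSup (hV.image _).bddAbove ⟨x, H.subset_vertexSet_of_mem_edgeSet he hx, rfl⟩
    have h2 : 0 < H.degree x :=
      (Set.ncard_pos (hEfin.subset fun e he => he.1)).2 ⟨e, he, hx⟩
    omega
  set m := H.edgeSet.ncard with hm
  set n := H.vertexSet.ncard with hn
  have hD : (0 : ℝ) < ((j + 2 : ℕ) : ℝ) * Δ := by positivity
  set x : ℝ := (m : ℝ) / (((j + 2 : ℕ) : ℝ) * Δ) with hx
  have hcx : max x₀ (max (t₀ + 1) 5) ≤ x := by
    rw [hx, le_div_iff₀ hD, ← mul_assoc]; exact hc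
  have hx0 : x₀ ≤ x := (le_max_left _ _).trans hcx
  have hxt : (t₀ + 1 : ℝ) ≤ x := ((le_max_left _ _).trans (le_max_right _ _)).trans hcx
  have hx5 : (5 : ℝ) ≤ x := ((le_max_right _ _).trans (le_max_right _ _)).trans hcx
  set t := ⌊x⌋₊ with ht
  have htx : (t : ℝ) ≤ x := Nat.floor_le (by linarith)
  have hxt1 : x < t + 1 := Nat.lt_floor_add_one x
  have htt : t₀ ≤ t := by
    have : (t₀ : ℝ) < t + 1 := by linarith
    exact Nat.lt_succ_iff.1 (by exact_mod_cast this)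
  have ht1 : (4 : ℝ) < t := by linarith
  have ht4 : 4 < t := by exact_mod_cast ht1
  obtain ⟨hκ, s, h1, h2⟩ := ht₀ t htt
  have htD : t * ((j + 2) * H.maxDegree) ≤ m := by
    rw [hΔ]
    have := (le_div_iff₀ hD).1 htx
    exact_mod_cast this
  have hcount := pow_le_choose_mul_of_not_hasRegularSubgraph H hr hk hV hH hreg htD hκ s h1 h2
  rw [hΔ] at hcount
  have hbound := le_of_pow_le_choose_mul (by omega) (by omega) hκ.le hcount
  set ℓ := Real.logb 2 (Real.logb 2 x) with hℓ
  have hℓ0 : 0 < ℓ := by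
    refine Real.logb_pos (by norm_num) ?_
    rw [Real.lt_logb_iff_rpow_lt (by norm_num) (by linarith)]
    norm_num
    linarith
  have hℓL : ℓ ≤ Real.log t :=
    (hx₀ x hx0).trans (Real.log_le_log (by linarith) (by linarith))
  have key := pow_mul_sqrt_le (j := j) (n := n) (t := t) (m := m) hΔ0 (by omega)
    (Nat.cast_nonneg m) (by rw [← hx]; linarith) (Real.log_pos (by linarith)) hℓL
    (by exact_mod_cast hbound)
  have hk1 : ((j + 2 : ℕ) : ℝ) - 1 = ((j + 1 : ℕ) : ℝ) := by push_cast; ring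
  have hj0 : ((j + 1 : ℕ) : ℝ) ≠ 0 := by positivity
  -- Raising to the power `k - 1 = j + 1` clears all the fractional exponents except the square
  -- root.
  refine le_of_pow_le_pow_left₀ (n := j + 1) (by omega) (by positivity) ?_
  rw [hk1, div_pow, mul_pow, mul_pow, ← Real.rpow_mul_natCast (Nat.cast_nonneg n),
    ← Real.rpow_mul_natCast (Nat.cast_nonneg Δ), ← Real.rpow_mul_natCast hℓ0.le,
    div_mul_cancel₀ _ hj0, div_mul_cancel₀ _ hj0, Real.rpow_natCast,
    show (((j + 2 : ℕ) : ℝ) - 2) = (j : ℕ) by push_cast; ring, Real.rpow_natCast,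
    show (1 : ℝ) / (2 * ((j + 1 : ℕ) : ℝ)) * ((j + 1 : ℕ) : ℝ) = 1 / 2 by field_simp,
    ← Real.sqrt_eq_rpow, le_div_iff₀ (Real.sqrt_pos.2 hℓ0)]
  exact key
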